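/- Let $\mathbb{C}_+$ be the open upper half-plane. Let $H^2(\mathbb{C}_+)$ be the Hardy space of analytic functions $f$ on $\mathbb{C}_+$ with $\|f\|=\sup_{y>0}\left(\int_{\mathbb{R}}|f(x+iy)|^2\,dx\right)^{1/2}<\infty$, a Hilbert space with inner product $\langle f,g\rangle=\lim_{y\to0^+}\int_{\mathbb{R}}f(x+iy)\overline{g(x+iy)}\,dx$ (equivalently, the $L^2(\mathbb{R})$ inner product of the boundary functions). Let $\chi$ be an inner function on $\mathbb{C}_+$, that is, an analytic function with $|\chi|\le 1$ on $\mathbb{C}_+$ whose boundary values satisfy $|\chi(x)|=1$ for almost every $x\in\mathbb{R}$, and let $H(\chi)=H^2(\mathbb{C}_+)\ominus\chi H^2(\mathbb{C}_+)$ be its model space, the orthogonal complement of $\chi H^2(\mathbb{C}_+)$ in $H^2(\mathbb{C}_+)$ with the norm of $H^2(\mathbb{C}_+)$. Let $\phi:\mathbb{C}_+\to\mathbb{C}_+$ be analytic and let $C_\phi f=f\circ\phi$. (1) If $C_\phi$ is a bounded operator from $H(\chi)$ to $H^2(\mathbb{C}_+)$, then $$\sup_{z\in\mathbb{C}_+}\frac{\operatorname{Im}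 z}{\operatorname{Im}\phi(z)}\left(1-|\chi(\phi(z))|^2\right)<\infty.$$ (2) If $$\sup_{z\in\mathbb{C}_+}\frac{\operatorname{Im} z}{\operatorname{Im}\phi(z)}<\infty,$$ then $C_\phi$ is a bounded operator from $H(\chi)$ to $H^2(\mathbb{C}_+)$. (3) If $\sup_{z\in\mathbb{C}_+}|\chi(\phi(z))|<1$, then the condition in (2) is also necessary: if $C_\phi$ is a bounded operator from $H(\chi)$ to $H^2(\mathbb{C}_+)$, then $\sup_{z\in\mathbb{C}_+}\operatorname{Im} z/\operatorname{Im}\phi(z)<\infty$. -/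

import Mathlib

open Filter Topology MeasureTheory UpperHalfPlane
open scoped ENNReal NNReal ComplexConjugate

namespace ModelComp

/-- Analyticity of a function on the open upper half-plane `ℍ`
(`ofComplex` is the inverse of the coercion `ℍ → ℂ` on the set `0 < Im z`). -/
def IsAnalytic (f : ℍ → ℂ) : Prop :=
  DifferentiableOn ℂ (fun z : ℂ => f (ofComplex z)) {z : ℂ | 0 < z.im}

/-- The restriction `x ↦ f (x + i y)` of `f` to the horizontal line at height `y`
(only used for `0 < y`). -/
noncomputable def slice (f : ℍ → ℂ) (y : ℝ) : ℝ → ℂ :=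
  fun x => f (ofComplex ((x : ℂ) + (y : ℂ) * Complex.I))

/-- The norm of the Hardy space, `sup_{y > 0} (∫ |f (x + i y)|² dx)^{1/2}`, with values
in `[0, ∞]`. -/
noncomputable def hardyNorm (f : ℍ → ℂ) : ℝ≥0∞ :=
  ⨆ (y : ℝ) (_ : 0 < y), eLpNorm (slice f y) 2 volume

theorem slice_continuous {f : ℍ → ℂ} (hf : IsAnalytic f) {y : ℝ} (hy : 0 < y) :
    Continuous (slice f y) := by
  have h : ContinuousOn (fun z : ℂ => f (ofComplex z)) {z : ℂ | 0 < z.im} := hf.continuousOn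
  exact h.comp_continuous (f := fun x : ℝ => (x : ℂ) + (y : ℂ) * Complex.I)
    (by fun_prop) (fun x => by simpa using hy)

theorem eLpNorm_slice_le (f : ℍ → ℂ) {y : ℝ} (hy : 0 < y) :
    eLpNorm (slice f y) 2 volume ≤ hardyNorm f :=
  le_iSup₂ (f := fun (y : ℝ) (_ : 0 < y) => eLpNorm (slice f y) 2 volume) y hy

/-- The Hardy space `H²(ℂ₊)`: analytic functions on the upper half-plane with finite norm. -/
def hardySpace : Submodule ℂ (ℍ → ℂ) where
  carrier := {f | IsAnalytic f ∧ hardyNorm f < ∞}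
  zero_mem' := by
    refine ⟨differentiableOn_const (c := (0 : ℂ)), ?_⟩
    have h : ∀ y, slice 0 y = 0 := fun y => rfl
    simp [hardyNorm, h]
  add_mem' := by
    rintro f g ⟨hf, hf'⟩ ⟨hg, hg'⟩
    refine ⟨DifferentiableOn.add hf hg, ?_⟩
    refine lt_of_le_of_lt (iSup₂_le fun y hy => ?_) (ENNReal.add_lt_top.2 ⟨hf', hg'⟩)
    exact (eLpNorm_add_le (slice_continuous hf hy).aestronglyMeasurable
      (slice_continuous hg hy).aestronglyMeasurable (by norm_num)).trans
      (add_le_add (eLpNorm_slice_le f hy) (eLpNorm_slice_le g hy))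
  smul_mem' := by
    rintro c f ⟨hf, hf'⟩
    refine ⟨DifferentiableOn.const_smul hf c, ?_⟩
    refine lt_of_le_of_lt (iSup₂_le fun y hy => ?_)
      (ENNReal.mul_lt_top (enorm_lt_top (x := c)) hf')
    have h : slice (c • f) y = c • slice f y := rfl
    rw [h, eLpNorm_const_smul]
    gcongr
    exact eLpNorm_slice_le f hy

theorem slice_memLp {f : ℍ → ℂ} (hf : f ∈ hardySpace) {y : ℝ} (hy : 0 < y) :
    MemLp (slice f y) 2 volume :=
  ⟨(slice_continuous hf.1 hy).aestronglyMeasurable, (eLpNorm_slice_le f hy).trans_lt hf.2⟩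

/-- `HasHardyInner f g c` says that the inner product of `f` and `g` in `H²(ℂ₊)` is `c`:
`⟨f, g⟩ = lim_{y → 0+} ∫ f (x + i y) conj (g (x + i y)) dx`.  For `f, g ∈ H²(ℂ₊)` the
restrictions to horizontal lines converge in `L²(ℝ)` to the boundary functions, so that the limit
exists and is `∫ f(t) conj (g(t)) dt` over the real line; for `f = g` it is the squared norm. -/
def HasHardyInner (f g : ℍ → ℂ) (c : ℂ) : Prop :=
  Tendsto (fun y : ℝ => ∫ x : ℝ, slice f y x * conj (slice g y x)) (𝓝[>] 0) (𝓝 c)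

/-- Inner functions of the upper half-plane: analytic, of modulus at most `1`, with unimodular
boundary values (vertical limits) at almost every point of the real line. -/
structure IsInner (χ : ℍ → ℂ) : Prop where
  analytic : IsAnalytic χ
  norm_le_one : ∀ z, ‖χ z‖ ≤ 1
  boundary : ∀ᵐ x : ℝ, ∃ ζ : ℂ, ‖ζ‖ = 1 ∧ Tendsto (fun y : ℝ => slice χ y x) (𝓝[>] 0) (𝓝 ζ)

theorem IsInner.mul_mem {χ g : ℍ → ℂ} (hχ : IsInner χ) (hg : g ∈ hardySpace) :
    χ * g ∈ hardySpace := by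
  refine ⟨DifferentiableOn.mul hχ.analytic hg.1, ?_⟩
  refine lt_of_le_of_lt (iSup₂_le fun y hy => ?_) hg.2
  refine (eLpNorm_mono fun x => ?_).trans (eLpNorm_slice_le g hy)
  change ‖χ _ * g _‖ ≤ ‖g _‖
  rw [norm_mul]
  exact mul_le_of_le_one_left (norm_nonneg _) (hχ.norm_le_one _)

/-- The model space `H(χ) = H²(ℂ₊) ⊖ χ H²(ℂ₊)` of an inner function `χ`: the elements of
`H²(ℂ₊)` that are orthogonal to `χ g` for every `g ∈ H²(ℂ₊)`. -/
def modelSpace {χ : ℍ → ℂ} (hχ : IsInner χ) : Submodule ℂ (ℍ → ℂ) where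
  carrier := {f | f ∈ hardySpace ∧ ∀ g ∈ hardySpace, HasHardyInner f (χ * g) 0}
  zero_mem' := by
    refine ⟨hardySpace.zero_mem, fun g _ => ?_⟩
    have h : ∀ y, slice 0 y = 0 := fun y => rfl
    simp [HasHardyInner, h]
  add_mem' := by
    rintro f₁ f₂ ⟨h₁, h₁'⟩ ⟨h₂, h₂'⟩
    refine ⟨hardySpace.add_mem h₁ h₂, fun g hg => ?_⟩
    have h := (h₁' g hg).add (h₂' g hg)
    rw [add_zero] at h
    refine h.congr' ?_
    filter_upwards [self_mem_nhdsWithin] with y hy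
    have hy : 0 < y := hy
    have hm := (slice_memLp (hχ.mul_mem hg) hy).star
    refine (integral_add ((slice_memLp h₁ hy).integrable_mul hm)
      ((slice_memLp h₂ hy).integrable_mul hm)).symm.trans ?_
    exact integral_congr_ae (.of_forall fun x => (add_mul _ _ _).symm)
  smul_mem' := by
    rintro c f ⟨hf, hf'⟩
    refine ⟨hardySpace.smul_mem c hf, fun g hg => ?_⟩
    have h := (hf' g hg).const_mul c
    rw [mul_zero] at h
    refine h.congr fun y => ?_
    rw [← integral_const_mul]
    exact integral_congr_ae (.of_forall fun x => (mul_assoc _ _ _).symm)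

/-- The composition operator `C_φ : f ↦ f ∘ φ` is a bounded operator from `V` to `H²(ℂ₊)`, where
`V` is a space of functions on the upper half-plane with the norm of `H²(ℂ₊)`. -/
def CompBounded (V : Submodule ℂ (ℍ → ℂ)) (φ : ℍ → ℍ) : Prop :=
  ∃ M : ℝ≥0, ∀ f ∈ V, f ∘ φ ∈ hardySpace ∧ hardyNorm (f ∘ φ) ≤ M * hardyNorm f

end ModelComp

/-!
Both directions go through Poisson and Cauchy integrals over horizontal lines `Im z = y > 0`, so that
boundary values on the real line enter only through the hypothesis `|χ| = 1` almost everywhere.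

*Boundedness on one line controls everything.* The mean value property on discs gives
`Im z * |g(z)|² ≤ 3 ‖g‖²` for `g` in the Hardy space (`enorm_sq_mul_im_le`). Hence Hardy functions are
bounded on closed half-planes inside the upper half-plane, where Cauchy's theorem on large rectangles
(`integral_line_eq_zero`) yields the Poisson formula `integral_line_mul_poissonWeight`.

*Necessity.* The test functions are the kernels `k_w(z) = (1 - conj χ(w) χ(z)) / (z - conj w)`. They
belong to the model space (`modelKernel_mem_modelSpace`), satisfy `|k_w(w)| = D / (2 Im w)` with
`D = 1 - |χ(w)|²`, and `‖k_w‖² ≤ 8 π D / Im w` (`hardyNorm_modelKernel_le`). For `w = φ(z)` the pointwise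
bound applied to `k_w ∘ φ` gives `Im z * (D / (2 Im w))² ≤ 24 π M² D / Im w`, that is, a bound for
`(Im z / Im w) * D`. When `|χ ∘ φ|` stays away from `1`, the factor `D` is bounded below.

*Sufficiency.* If `Im z ≤ M Im φ(z)`, then `|f|²` is at most the Poisson integral of `|f|²` from a line
just above the real axis. For each `t` on that line the Poisson kernel at `φ(z)` is, up to the factor
`1 / π`, the positive harmonic function `Im (-1 / (φ(z) - t))`, whose integral over a horizontal line is
at most `π M` because its growth along the imaginary axis is at most `M / Im z`
(`lintegral_poissonWeight_comp_le`). Tonelli's theorem then gives `‖f ∘ φ‖² ≤ M ‖f‖²` on the whole Hardy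
space (`hardyNorm_comp_le`).
-/

namespace ModelComp

/-! ### Integrals over horizontal lines -/

theorem norm_ofReal_add_mul_I_ge_abs_re (x y : ℝ) :
    |x| ≤ ‖(x : ℂ) + (y : ℂ) * Complex.I‖ := by
  simpa using Complex.abs_re_le_norm ((x : ℂ) + (y : ℂ) * Complex.I)

theorem norm_ofReal_add_mul_I_ge_abs_im (x y : ℝ) :
    |y| ≤ ‖(x : ℂ) + (y : ℂ) * Complex.I‖ := by
  simpa using Complex.abs_im_le_norm ((x : ℂ) + (y : ℂ) * Complex.I)

/-- Cauchy's theorem on a half-plane: the other three sides of the rectangle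
`[-R, R] × [y, R]` contribute `O(1 / R)`. -/
theorem integral_line_eq_zero {F : ℂ → ℂ} {y C R₀ : ℝ} (hF : DifferentiableOn ℂ F {z | y ≤ z.im})
    (hdecay : ∀ z : ℂ, y ≤ z.im → R₀ ≤ ‖z‖ → ‖F z‖ ≤ C / ‖z‖ ^ 2)
    (hint : Integrable fun x : ℝ => F (x + y * Complex.I)) :
    ∫ x : ℝ, F (x + y * Complex.I) = 0 := by
  have hlim := intervalIntegral_tendsto_integral hint tendsto_neg_atTop_atBot tendsto_id
  refine tendsto_nhds_unique hlim (squeeze_zero_norm' (a := fun R : ℝ => 6 * |C| / R) ?_ ?_)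
  · filter_upwards [eventually_ge_atTop (max (max R₀ |y|) 1)] with R hR
    have hR1 : 1 ≤ R := (le_max_right _ _).trans hR
    have hR0 : R₀ ≤ R := (le_max_left _ _).trans ((le_max_left _ _).trans hR)
    have hRy' : |y| ≤ R := (le_max_right _ _).trans ((le_max_left _ _).trans hR)
    have hRy : y ≤ R := (le_abs_self y).trans hRy'
    have hRpos : 0 < R := by linarith
    have key := Complex.integral_boundary_rect_eq_zero_of_differentiableOn F
      (((-R : ℝ) : ℂ) + (y : ℂ) * Complex.I) ((R : ℂ) + (R : ℂ) * Complex.I)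
      (hF.mono fun z hz => by
        have := hz.2
        simp only [Set.mem_preimage, Complex.add_im, Complex.ofReal_im, Complex.mul_im,
          Complex.ofReal_re, Complex.I_im, Complex.I_re] at this
        norm_num at this
        rw [Set.uIcc_of_le hRy] at this
        exact this.1)
    simp only [Complex.add_re, Complex.ofReal_re, Complex.mul_re, Complex.I_re, Complex.ofReal_im,
      Complex.I_im, Complex.add_im, Complex.mul_im] at key
    simp only [mul_zero, mul_one, sub_zero, add_zero, zero_add] at key
    have bound : ∀ z : ℂ, y ≤ z.im → R ≤ ‖z‖ → ‖F z‖ ≤ |C| / R ^ 2 := fun z hz hRz => by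
      refine (hdecay z hz (hR0.trans hRz)).trans ?_
      gcongr
      exact le_abs_self C
    have htop : ‖∫ x : ℝ in -R..R, F (x + R * Complex.I)‖ ≤ |C| / R ^ 2 * |R - -R| := by
      refine intervalIntegral.norm_integral_le_of_norm_le_const fun x _ => bound _ (by simpa) ?_
      exact (le_abs_self R).trans (norm_ofReal_add_mul_I_ge_abs_im x R)
    have hside : ∀ s : ℝ, |s| = R →
        ‖∫ t : ℝ in y..R, F ((s : ℂ) + t * Complex.I)‖ ≤ |C| / R ^ 2 * |R - y| := by
      intro s hs
      refine intervalIntegral.norm_integral_le_of_norm_le_const fun t ht => bound _ ?_ ?_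
      · rw [Set.uIoc_of_le hRy] at ht
        simpa using ht.1.le
      · exact hs.symm.le.trans (norm_ofReal_add_mul_I_ge_abs_re s t)
    have hr := hside R (abs_of_pos hRpos)
    have hl := hside (-R) (by rw [abs_neg, abs_of_pos hRpos])
    have hI : ∀ c : ℂ, ‖Complex.I • c‖ = ‖c‖ := fun c => by simp
    have hyR : |R - y| ≤ 2 * R := by
      rw [abs_le] at hRy' ⊢
      constructor <;> linarith
    have h2R : |R - -R| = 2 * R := by rw [abs_of_pos] <;> linarith
    rw [h2R] at htop
    have hbot : ∫ x : ℝ in -R..R, F (x + y * Complex.I) =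
        (∫ x : ℝ in -R..R, F (x + R * Complex.I)) -
          Complex.I • (∫ t : ℝ in y..R, F ((R : ℂ) + t * Complex.I)) +
          Complex.I • ∫ t : ℝ in y..R, F (((-R : ℝ) : ℂ) + t * Complex.I) := by
      linear_combination key
    change ‖∫ x : ℝ in -R..R, F (x + y * Complex.I)‖ ≤ _
    rw [hbot]
    refine (norm_add_le _ _).trans ((add_le_add_left (norm_sub_le _ _) _).trans ?_)
    rw [hI, hI]
    calc _ ≤ |C| / R ^ 2 * (2 * R) + |C| / R ^ 2 * (2 * R) + |C| / R ^ 2 * (2 * R) := by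
          gcongr
          · exact hr.trans (by gcongr)
          · exact hl.trans (by gcongr)
      _ = 6 * |C| / R := by
          field_simp
          ring
  · exact tendsto_const_nhds.div_atTop tendsto_id

/-- The function `(F - F p) / (z - p)` has a removable singularity at `p`, so that Cauchy's theorem
applies to it after multiplication by a factor `k` that decays like `1 / |z|`. -/
theorem integral_line_slope_mul_eq_zero {F k : ℂ → ℂ} {y B C R₀ : ℝ} {p : ℂ} (hp : y < p.im)
    (hF : DifferentiableOn ℂ F {z | y ≤ z.im}) (hB : ∀ z : ℂ, y ≤ z.im → ‖F z‖ ≤ B)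
    (hk : DifferentiableOn ℂ k {z | y ≤ z.im})
    (hdecay : ∀ z : ℂ, y ≤ z.im → R₀ ≤ ‖z‖ → ‖k z‖ ≤ C / ‖z‖)
    (hint : Integrable fun x : ℝ => (F (x + y * Complex.I) - F p) / (x + y * Complex.I - p) *
      k (x + y * Complex.I)) :
    ∫ x : ℝ, (F (x + y * Complex.I) - F p) / (x + y * Complex.I - p) * k (x + y * Complex.I)
      = 0 := by
  have hnhds : {z : ℂ | y ≤ z.im} ∈ 𝓝 p :=
    mem_of_superset ((isOpen_lt continuous_const Complex.continuous_im).mem_nhds hp)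
      fun z (hz : y < z.im) => hz.le
  have hslope : ∀ z : ℂ, z ≠ p → dslope F p z = (F z - F p) / (z - p) := fun z hz => by
    rw [dslope_of_ne _ hz, slope_def_field]
  have hline : ∀ x : ℝ, dslope F p (x + y * Complex.I) * k (x + y * Complex.I) =
      (F (x + y * Complex.I) - F p) / (x + y * Complex.I - p) * k (x + y * Complex.I) := by
    intro x
    rw [hslope]
    rintro rfl
    simp at hp
  simp_rw [← hline] at hint ⊢
  refine integral_line_eq_zero (F := fun z => dslope F p z * k z) (C := 4 * B * C)
    (R₀ := max R₀ (2 * ‖p‖ + 1))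
    (((Complex.differentiableOn_dslope hnhds).2 hF).mul hk) (fun z hz hzR => ?_) hint
  have hz0 : R₀ ≤ ‖z‖ := (le_max_left _ _).trans hzR
  have hzp : 2 * ‖p‖ + 1 ≤ ‖z‖ := (le_max_right _ _).trans hzR
  have hzpos : 0 < ‖z‖ := by linarith [norm_nonneg p]
  have hdist : ‖z‖ / 2 ≤ ‖z - p‖ := by linarith [norm_sub_norm_le z p, norm_nonneg p]
  have hne : z ≠ p := by
    rintro rfl
    linarith [norm_nonneg z]
  have hB0 : 0 ≤ B := (norm_nonneg _).trans (hB p hp.le)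
  have hnum : ‖F z - F p‖ ≤ 2 * B :=
    (norm_sub_le _ _).trans (by linarith [hB z hz, hB p hp.le])
  rw [norm_mul, hslope z hne, norm_div]
  calc _ ≤ 2 * B / (‖z‖ / 2) * (C / ‖z‖) := by
        gcongr
        exact hdecay z hz hz0
    _ = 4 * B * C / ‖z‖ ^ 2 := by
        field_simp
        ring

/-! ### The Poisson formula -/

/-- The Poisson kernel of a half-plane at height `s` above its boundary line, centred at `a`,
without its factor `s / π`. -/
noncomputable def poissonWeight (a s x : ℝ) : ℝ := ((x - a) ^ 2 + s ^ 2)⁻¹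

theorem poissonWeight_nonneg (a s x : ℝ) : 0 ≤ poissonWeight a s x := by
  unfold poissonWeight
  positivity

theorem continuous_poissonWeight (a : ℝ) {s : ℝ} (hs : 0 < s) : Continuous (poissonWeight a s) := by
  unfold poissonWeight
  refine Continuous.inv₀ (by fun_prop) fun x => ?_
  positivity

theorem poissonWeight_eq (a : ℝ) {s : ℝ} (hs : 0 < s) :
    poissonWeight a s = fun x => (s ^ 2)⁻¹ * (fun t : ℝ => (1 + (t / s) ^ 2)⁻¹) (x - a) := by
  ext x
  unfold poissonWeight
  field_simp
  ring

theorem integrable_poissonWeight (a : ℝ) {s : ℝ} (hs : 0 < s) :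
    Integrable (poissonWeight a s) := by
  rw [poissonWeight_eq a hs]
  exact ((integrable_inv_one_add_sq.comp_div hs.ne').comp_sub_right a).const_mul _

theorem integral_poissonWeight (a : ℝ) {s : ℝ} (hs : 0 < s) :
    ∫ x, poissonWeight a s x = Real.pi / s := by
  rw [poissonWeight_eq a hs, integral_const_mul,
    integral_sub_right_eq_self (fun t : ℝ => (1 + (t / s) ^ 2)⁻¹) a,
    Measure.integral_comp_div (fun t : ℝ => (1 + t ^ 2)⁻¹) s, integral_univ_inv_one_add_sq,
    abs_of_pos hs, smul_eq_mul]
  field_simp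

/-- The weight is the squared modulus of the Cauchy kernel along the line at height `y`. -/
theorem poissonWeight_eq_norm (p : ℂ) (y x : ℝ) :
    poissonWeight p.re (p.im - y) x = (‖(x : ℂ) + y * Complex.I - p‖ ^ 2)⁻¹ := by
  rw [poissonWeight, ← Complex.normSq_eq_norm_sq, Complex.normSq_apply]
  simp
  ring

/-- The product of the Cauchy kernels of `p` and of its reflection in the line at height `y`. -/
theorem poissonWeight_eq_mul (p : ℂ) (y x : ℝ) :
    ((poissonWeight p.re (p.im - y) x : ℝ) : ℂ) = (x + y * Complex.I - p)⁻¹ *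
      (x + y * Complex.I - (conj p + 2 * y * Complex.I))⁻¹ := by
  rw [← mul_inv, poissonWeight, Complex.ofReal_inv]
  congr 1
  apply Complex.ext <;> simp [pow_two] <;> ring

theorem continuous_line {F : ℂ → ℂ} {y : ℝ} (hF : DifferentiableOn ℂ F {z | y ≤ z.im}) :
    Continuous fun x : ℝ => F (x + y * Complex.I) :=
  hF.continuousOn.comp_continuous (f := fun x : ℝ => (x : ℂ) + y * Complex.I)
    (by fun_prop) fun x => by simp

theorem integrable_mul_poissonWeight {F : ℝ → ℂ} {B s : ℝ} (hF : Continuous F)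
    (hB : ∀ x, ‖F x‖ ≤ B) (a : ℝ) (hs : 0 < s) :
    Integrable fun x : ℝ => F x * (poissonWeight a s x : ℝ) :=
  ((integrable_poissonWeight a hs).ofReal (𝕜 := ℂ)).bdd_mul hF.aestronglyMeasurable
    (.of_forall hB)

/-- The Poisson formula for a bounded analytic function on a closed half-plane. -/
theorem integral_line_mul_poissonWeight {F : ℂ → ℂ} {y B : ℝ} {p : ℂ} (hp : y < p.im)
    (hF : DifferentiableOn ℂ F {z | y ≤ z.im}) (hB : ∀ z : ℂ, y ≤ z.im → ‖F z‖ ≤ B) :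
    ∫ x : ℝ, F (x + y * Complex.I) * (poissonWeight p.re (p.im - y) x : ℝ) =
      (Real.pi / (p.im - y) : ℝ) * F p := by
  have hs : 0 < p.im - y := sub_pos.2 hp
  set q : ℂ := conj p + 2 * y * Complex.I with hq
  have hqim : q.im < y := by
    simp [hq]
    linarith
  have hkne : ∀ z : ℂ, y ≤ z.im → z - q ≠ 0 := fun z hz h => by
    rw [sub_eq_zero] at h
    rw [h] at hz
    linarith
  have h1 := integrable_mul_poissonWeight (continuous_line hF)
    (fun x => hB _ (by simp)) p.re hs
  have h2 : Integrable fun x : ℝ => F p * (poissonWeight p.re (p.im - y) x : ℝ) :=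
    ((integrable_poissonWeight p.re hs).ofReal (𝕜 := ℂ)).const_mul (F p)
  have hrew : ∀ x : ℝ, (F (x + y * Complex.I) - F p) / (x + y * Complex.I - p) *
      (x + y * Complex.I - q)⁻¹ = F (x + y * Complex.I) * (poissonWeight p.re (p.im - y) x : ℝ) -
        F p * (poissonWeight p.re (p.im - y) x : ℝ) := by
    intro x
    rw [poissonWeight_eq_mul]
    ring
  have hzero := integral_line_slope_mul_eq_zero (k := fun z => (z - q)⁻¹) (C := 2)
    (R₀ := 2 * ‖q‖ + 1) hp hF hB
    (DifferentiableOn.inv (by fun_prop) hkne) (fun z _ hzR => ?_) ?_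
  · simp_rw [hrew] at hzero
    rw [integral_sub h1 h2, integral_const_mul, integral_complex_ofReal,
      integral_poissonWeight _ hs] at hzero
    rw [sub_eq_zero.1 hzero, mul_comm]
  · have hz0 : 0 < ‖z‖ := by linarith [norm_nonneg q]
    have : ‖z‖ / 2 ≤ ‖z - q‖ := by linarith [norm_sub_norm_le z q, norm_nonneg q]
    rw [norm_inv]
    calc _ ≤ (‖z‖ / 2)⁻¹ := by gcongr
      _ = 2 / ‖z‖ := by field_simp
  · simp_rw [hrew]
    exact h1.sub h2

/-! ### Point evaluations on the Hardy space -/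

theorem eLpNorm_two_sq (f : ℝ → ℂ) : eLpNorm f 2 volume ^ 2 = ∫⁻ x, ‖f x‖ₑ ^ 2 := by
  simpa using eLpNorm_nnreal_pow_eq_lintegral (f := f) (μ := volume) (p := 2) two_ne_zero

theorem lintegral_slice_sq_le (f : ℍ → ℂ) {y : ℝ} (hy : 0 < y) :
    ∫⁻ x, ‖slice f y x‖ₑ ^ 2 ≤ hardyNorm f ^ 2 := by
  rw [← eLpNorm_two_sq]
  gcongr
  exact eLpNorm_slice_le f hy

theorem hardyNorm_le {f : ℍ → ℂ} {C : ℝ≥0∞}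
    (h : ∀ y, 0 < y → ∫⁻ x, ‖slice f y x‖ₑ ^ 2 ≤ C ^ 2) : hardyNorm f ≤ C := by
  refine iSup₂_le fun y hy => ?_
  have := h y hy
  rw [← eLpNorm_two_sq] at this
  exact (ENNReal.pow_le_pow_left_iff two_ne_zero).1 this

/-- The mean value property of `F ^ 2` on a circle. -/
theorem enorm_sq_mul_le_lintegral_circle {F : ℂ → ℂ} {c : ℂ} {r : ℝ}
    (hF : DiffContOnCl ℂ F (Metric.ball c |r|)) :
    ENNReal.ofReal (2 * Real.pi) * ‖F c‖ₑ ^ 2 ≤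
      ∫⁻ θ in Set.Ioo (-Real.pi) Real.pi, ‖F (circleMap c r θ)‖ₑ ^ 2 := by
  have hmean := (hF.smul hF).circleAverage
  have hper : Function.Periodic (fun θ => F (circleMap c r θ) • F (circleMap c r θ)) (2 * Real.pi) :=
    fun θ => by simp only [periodic_circleMap c r θ]
  have hshift := hper.intervalIntegral_add_eq 0 (-Real.pi)
  rw [zero_add, show -Real.pi + 2 * Real.pi = Real.pi by ring] at hshift
  rw [Real.circleAverage, hshift, inv_smul_eq_iff₀ (by positivity)] at hmean
  have hn := congrArg enorm hmean
  rw [enorm_smul (2 * Real.pi), smul_eq_mul, enorm_mul (F c), ← pow_two,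
    Real.enorm_of_nonneg (by positivity)] at hn
  rw [← hn, intervalIntegral.integral_of_le (by linarith [Real.pi_pos]),
    setIntegral_congr_set Ioo_ae_eq_Ioc.symm]
  refine (enorm_integral_le_lintegral_enorm _).trans_eq (lintegral_congr fun θ => ?_)
  simp [pow_two]

/-- The value of an analytic function at the centre of a disc is controlled by its `L²` norm on the
disc.  Only the annulus `r / 2 < |q| < r` is used, at the cost of a worse constant. -/
theorem enorm_sq_mul_le_lintegral_disc {F : ℂ → ℂ} {c : ℂ} {r : ℝ} (hr : 0 < r)
    (hF : DifferentiableOn ℂ F (Metric.closedBall c r)) :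
    ENNReal.ofReal (Real.pi * r ^ 2 / 2) * ‖F c‖ₑ ^ 2 ≤
      ∫⁻ q : ℝ × ℝ, {q : ℝ × ℝ | q.1 ^ 2 + q.2 ^ 2 < r ^ 2}.indicator
        (fun q => ‖F (c + (q.1 + q.2 * Complex.I))‖ₑ ^ 2) q := by
  set S := {q : ℝ × ℝ | q.1 ^ 2 + q.2 ^ 2 < r ^ 2} with hS
  set H := S.indicator (fun q : ℝ × ℝ => ‖F (c + (q.1 + q.2 * Complex.I))‖ₑ ^ 2) with hH
  have hmeas : Measurable H := by
    have hmS : MeasurableSet S := (isOpen_lt (by fun_prop) continuous_const).measurableSet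
    have hmaps : Set.MapsTo (fun q : ℝ × ℝ => c + ((q.1 : ℂ) + q.2 * Complex.I)) S
        (Metric.closedBall c r) := fun q hq => by
      have hq' : q.1 ^ 2 + q.2 ^ 2 < r ^ 2 := hq
      rw [mem_closedBall_iff_norm, add_sub_cancel_left, ← abs_of_pos hr, ← abs_norm, ← sq_le_sq,
        ← Complex.normSq_eq_norm_sq, Complex.normSq_add_mul_I]
      exact hq'.le
    classical
    rw [hH, ← Set.piecewise_eq_indicator]
    refine ContinuousOn.measurable_piecewise ?_ continuousOn_const hmS
    exact (ENNReal.continuous_pow 2).comp_continuousOn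
      (hF.continuousOn.comp (by fun_prop) hmaps).enorm
  have hpolar : ∀ ρ ∈ Set.Ioo (r / 2) r, ∀ θ : ℝ,
      H (polarCoord.symm (ρ, θ)) = ‖F (circleMap c ρ θ)‖ₑ ^ 2 := by
    intro ρ hρ θ
    have hρ0 : 0 < ρ := by linarith [hρ.1]
    have hmem : polarCoord.symm (ρ, θ) ∈ S := by
      change (ρ * Real.cos θ) ^ 2 + (ρ * Real.sin θ) ^ 2 < r ^ 2
      rw [mul_pow, mul_pow, ← mul_add, Real.cos_sq_add_sin_sq, mul_one]
      gcongr
      exact hρ.2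
    rw [hH, Set.indicator_of_mem hmem]
    congr 4
    simp [polarCoord, Complex.exp_mul_I]
    ring
  have hmeas' : Measurable fun p : ℝ × ℝ => ENNReal.ofReal p.1 • H (polarCoord.symm p) :=
    (ENNReal.measurable_ofReal.comp measurable_fst).smul
      (hmeas.comp continuous_polarCoord_symm.measurable)
  rw [← lintegral_comp_polarCoord_symm]
  calc _ = ∫⁻ _ρ in Set.Ioo (r / 2) r,
        ENNReal.ofReal (r / 2) * (ENNReal.ofReal (2 * Real.pi) * ‖F c‖ₑ ^ 2) := by
        rw [setLIntegral_const, Real.volume_Ioo, sub_half, mul_right_comm, ← mul_assoc,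
          ← ENNReal.ofReal_mul (by positivity), mul_assoc, ← mul_assoc (ENNReal.ofReal (r / 2 * _)),
          ← ENNReal.ofReal_mul (by positivity)]
        congr 2
        ring
    _ ≤ ∫⁻ ρ in Set.Ioo (r / 2) r, ∫⁻ θ in Set.Ioo (-Real.pi) Real.pi,
          ENNReal.ofReal ρ • H (polarCoord.symm (ρ, θ)) := by
        refine setLIntegral_mono' measurableSet_Ioo fun ρ hρ => ?_
        have hρ0 : 0 < ρ := by linarith [hρ.1]
        simp_rw [hpolar ρ hρ, smul_eq_mul]
        rw [lintegral_const_mul' _ _ ENNReal.ofReal_ne_top]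
        gcongr
        · exact hρ.1.le
        · refine enorm_sq_mul_le_lintegral_circle ?_
          rw [abs_of_pos hρ0]
          exact hF.diffContOnCl_ball (Metric.closedBall_subset_closedBall hρ.2.le)
    _ ≤ ∫⁻ ρ in Set.Ioi (0 : ℝ), ∫⁻ θ in Set.Ioo (-Real.pi) Real.pi,
          ENNReal.ofReal ρ • H (polarCoord.symm (ρ, θ)) :=
        lintegral_mono_set fun ρ hρ => by
          have := hρ.1
          exact lt_trans (by positivity) this
    _ = _ := by
        rw [← lintegral_prod _ hmeas'.aemeasurable, Measure.prod_restrict]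
        rfl

/-- Point evaluations are bounded on the Hardy space. -/
theorem enorm_sq_mul_im_le {g : ℍ → ℂ} (hg : IsAnalytic g) {z : ℂ} (hz : 0 < z.im) :
    ENNReal.ofReal z.im * ‖g (ofComplex z)‖ₑ ^ 2 ≤ 3 * hardyNorm g ^ 2 := by
  set r := z.im / 2 with hr
  have hr0 : 0 < r := by positivity
  have hball : Metric.closedBall z r ⊆ {w : ℂ | 0 < w.im} := fun w hw => by
    have := (Complex.abs_im_le_norm (w - z)).trans (mem_closedBall_iff_norm.1 hw)
    rw [Complex.sub_im, abs_le] at this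
    change 0 < w.im
    linarith [this.1]
  have h1 := enorm_sq_mul_le_lintegral_disc hr0 (hg.mono hball)
  have h2 : ∫⁻ q : ℝ × ℝ, {q : ℝ × ℝ | q.1 ^ 2 + q.2 ^ 2 < r ^ 2}.indicator
        (fun q => ‖g (ofComplex (z + (q.1 + q.2 * Complex.I)))‖ₑ ^ 2) q ≤
      ENNReal.ofReal z.im * hardyNorm g ^ 2 := by
    rw [Measure.volume_eq_prod, ← lintegral_prod_swap]
    refine (lintegral_prod_le _).trans ?_
    calc _ ≤ ∫⁻ y : ℝ, (Set.Ioo (-r) r).indicator (fun _ => hardyNorm g ^ 2) y := by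
          refine lintegral_mono fun y => ?_
          by_cases hy : y ∈ Set.Ioo (-r) r
          · rw [Set.indicator_of_mem hy]
            refine le_trans ?_ (lintegral_slice_sq_le g (y := z.im + y) (by linarith [hy.1]))
            rw [← lintegral_add_left_eq_self (fun x => ‖slice g (z.im + y) x‖ₑ ^ 2) z.re]
            refine lintegral_mono fun x => (Set.indicator_le_self _ _ _).trans_eq ?_
            simp only [Prod.fst_swap, Prod.snd_swap, slice]
            congr 4
            apply Complex.ext <;> simp
          · rw [Set.indicator_of_notMem hy]
            refine (lintegral_eq_zero_of_ae_eq_zero (.of_forall fun x => ?_)).le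
            refine Set.indicator_of_notMem (fun hx => hy ?_) _
            have hx' : x ^ 2 + y ^ 2 < r ^ 2 := hx
            have : y ^ 2 < r ^ 2 := by linarith [sq_nonneg x]
            exact abs_lt.1 (abs_lt_of_sq_lt_sq this hr0.le)
      _ = ENNReal.ofReal z.im * hardyNorm g ^ 2 := by
          rw [lintegral_indicator measurableSet_Ioo, setLIntegral_const, Real.volume_Ioo, mul_comm]
          congr 2
          linarith
  have h3 := h1.trans h2
  have hπ := Real.pi_gt_three
  -- the constant is `8 / π < 3`
  have h4 : ENNReal.ofReal z.im ≤ ENNReal.ofReal (3 / z.im) * ENNReal.ofReal (Real.pi * r ^ 2 / 2)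
      := by
    rw [← ENNReal.ofReal_mul (by positivity)]
    refine ENNReal.ofReal_le_ofReal ?_
    rw [hr]
    field_simp
    linarith
  calc _ ≤ ENNReal.ofReal (3 / z.im) * ENNReal.ofReal (Real.pi * r ^ 2 / 2) *
          ‖g (ofComplex z)‖ₑ ^ 2 := by gcongr
    _ ≤ ENNReal.ofReal (3 / z.im) * (ENNReal.ofReal z.im * hardyNorm g ^ 2) := by
        rw [mul_assoc]
        gcongr
    _ = 3 * hardyNorm g ^ 2 := by
        rw [← mul_assoc, ← ENNReal.ofReal_mul (by positivity), div_mul_cancel₀ _ hz.ne']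
        simp

theorem im_mul_norm_sq_le {g : ℍ → ℂ} (hg : g ∈ hardySpace) {z : ℂ} (hz : 0 < z.im) :
    z.im * ‖g (ofComplex z)‖ ^ 2 ≤ 3 * (hardyNorm g).toReal ^ 2 := by
  have h := ENNReal.toReal_mono (ENNReal.mul_ne_top (by norm_num) (ENNReal.pow_ne_top hg.2.ne))
    (enorm_sq_mul_im_le hg.1 hz)
  simpa [ENNReal.toReal_mul, ENNReal.toReal_pow, hz.le] using h

theorem differentiableOn_closed {f : ℍ → ℂ} (hf : IsAnalytic f) {y : ℝ} (hy : 0 < y) :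
    DifferentiableOn ℂ (fun z : ℂ => f (ofComplex z)) {z | y ≤ z.im} :=
  hf.mono fun _ (hz : y ≤ _) => hy.trans_le hz

theorem exists_norm_le_of_mem_hardySpace {g : ℍ → ℂ} (hg : g ∈ hardySpace) {y : ℝ} (hy : 0 < y) :
    ∃ B, ∀ z : ℂ, y ≤ z.im → ‖g (ofComplex z)‖ ≤ B := by
  refine ⟨√(3 * (hardyNorm g).toReal ^ 2 / y), fun z hz => Real.le_sqrt_of_sq_le ?_⟩
  rw [le_div_iff₀' hy]
  exact (mul_le_mul_of_nonneg_right hz (sq_nonneg _)).trans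
    (im_mul_norm_sq_le hg (hy.trans_le hz))

theorem enorm_ofReal_of_nonneg {r : ℝ} (hr : 0 ≤ r) : ‖(r : ℂ)‖ₑ = ENNReal.ofReal r := by
  rw [← ofReal_norm, Complex.norm_of_nonneg hr]

/-! ### Composition with a symbol whose imaginary part dominates that of the variable -/

/-- The Poisson integral of `|f|²` majorizes `|f|²`.  This is the Poisson formula for `f ^ 2`. -/
theorem enorm_sq_le_lintegral_poisson {f : ℍ → ℂ} (hf : f ∈ hardySpace) {y : ℝ} (hy : 0 < y)
    {p : ℂ} (hp : y < p.im) :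
    ‖f (ofComplex p)‖ₑ ^ 2 ≤ ∫⁻ t : ℝ, ENNReal.ofReal Real.pi⁻¹ * (‖slice f y t‖ₑ ^ 2 *
      ENNReal.ofReal ((p.im - y) * poissonWeight p.re (p.im - y) t)) := by
  have hs : 0 < p.im - y := sub_pos.2 hp
  have hπ := Real.pi_pos
  obtain ⟨B, hB⟩ := exists_norm_le_of_mem_hardySpace hf hy
  have hP := integral_line_mul_poissonWeight (F := fun z => f (ofComplex z) ^ 2) (B := B ^ 2) hp
    ((differentiableOn_closed hf.1 hy).pow 2) fun z hz => by
      rw [norm_pow]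
      gcongr
      exact hB z hz
  have hn := enorm_integral_le_lintegral_enorm (μ := volume) fun t : ℝ =>
    slice f y t ^ 2 * (poissonWeight p.re (p.im - y) t : ℂ)
  have hP' : ∫ t : ℝ, slice f y t ^ 2 * (poissonWeight p.re (p.im - y) t : ℂ) = _ := hP
  rw [hP', enorm_mul, enorm_pow, enorm_ofReal_of_nonneg (by positivity)] at hn
  have hc : ENNReal.ofReal ((p.im - y) / Real.pi) * ENNReal.ofReal (Real.pi / (p.im - y)) = 1 := by
    rw [← ENNReal.ofReal_mul (by positivity), div_mul_div_cancel₀ hπ.ne', div_self hs.ne',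
      ENNReal.ofReal_one]
  calc ‖f (ofComplex p)‖ₑ ^ 2 = ENNReal.ofReal ((p.im - y) / Real.pi) *
        (ENNReal.ofReal (Real.pi / (p.im - y)) * ‖f (ofComplex p)‖ₑ ^ 2) := by
        rw [← mul_assoc, hc, one_mul]
    _ ≤ ENNReal.ofReal ((p.im - y) / Real.pi) * ∫⁻ t : ℝ,
        ‖slice f y t ^ 2 * (poissonWeight p.re (p.im - y) t : ℂ)‖ₑ := by gcongr
    _ = _ := by
        rw [← lintegral_const_mul' _ _ ENNReal.ofReal_ne_top]
        refine lintegral_congr fun t => ?_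
        rw [enorm_mul, enorm_pow,
          enorm_ofReal_of_nonneg (poissonWeight_nonneg _ _ _), ENNReal.ofReal_mul hs.le,
          div_eq_inv_mul, ENNReal.ofReal_mul (by positivity)]
        ring

/-- The total mass of the boundary values of a positive harmonic function `Im G` is bounded by
its growth along the imaginary axis: multiply the Poisson formula at height `s` by `s` and let
`s → ∞`. -/
theorem lintegral_im_line_le {G : ℂ → ℂ} {y B M : ℝ} (hG : DifferentiableOn ℂ G {z | y ≤ z.im})
    (hB : ∀ z : ℂ, y ≤ z.im → ‖G z‖ ≤ B)
    (hpos : ∀ x : ℝ, 0 ≤ (G (x + y * Complex.I)).im)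
    (hM : ∀ s : ℝ, 0 < s → s * (G ((y + s : ℝ) * Complex.I)).im ≤ M) :
    ∫⁻ x : ℝ, ENNReal.ofReal (G (x + y * Complex.I)).im ≤ ENNReal.ofReal (Real.pi * M) := by
  set h : ℝ → ℝ := fun x => (G (x + y * Complex.I)).im with hh
  have hcont : Continuous h := Complex.continuous_im.comp (continuous_line hG)
  have hbound : ∀ s : ℝ, 0 < s →
      ∫⁻ x, ENNReal.ofReal (h x * (s ^ 2 * poissonWeight 0 s x)) ≤ ENNReal.ofReal (Real.pi * M) := by
    intro s hs
    have hp : y < ((y + s : ℝ) * Complex.I : ℂ).im := by simpa using hs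
    have hP := integral_line_mul_poissonWeight hp hG hB
    have hint := integrable_mul_poissonWeight (continuous_line hG) (fun x => hB _ (by simp))
      0 hs
    have hre : ((y + s : ℝ) * Complex.I : ℂ).re = 0 := by simp
    have him : ((y + s : ℝ) * Complex.I : ℂ).im - y = s := by simp
    rw [hre, him] at hP
    have hPim := congrArg Complex.im hP
    rw [Complex.im_ofReal_mul] at hPim
    have hI : ∫ x : ℝ, h x * poissonWeight 0 s x =
        (∫ x : ℝ, G (x + y * Complex.I) * (poissonWeight 0 s x : ℝ)).im := by
      refine Eq.trans ?_ (integral_im (𝕜 := ℂ) hint)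
      exact integral_congr_ae (.of_forall fun x => (Complex.im_mul_ofReal _ _).symm)
    have hint' : Integrable fun x : ℝ => h x * poissonWeight 0 s x := by
      refine hint.im.congr (.of_forall fun x => ?_)
      exact Complex.im_mul_ofReal _ _
    simp_rw [mul_left_comm _ (s ^ 2)]
    rw [← ofReal_integral_eq_lintegral_ofReal (hint'.const_mul _)
      (.of_forall fun x => mul_nonneg (sq_nonneg s)
        (mul_nonneg (hpos x) (poissonWeight_nonneg _ _ _))), integral_const_mul, hI, hPim]
    refine ENNReal.ofReal_le_ofReal ?_
    calc _ = Real.pi * (s * (G ((y + s : ℝ) * Complex.I)).im) := by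
          field_simp
      _ ≤ Real.pi * M := mul_le_mul_of_nonneg_left (hM s hs) Real.pi_pos.le
  have hlim : ∀ x, Tendsto (fun n : ℕ => ENNReal.ofReal
      (h x * (((n : ℝ) + 1) ^ 2 * poissonWeight 0 ((n : ℝ) + 1) x))) atTop
      (𝓝 (ENNReal.ofReal (h x))) := by
    intro x
    refine ENNReal.tendsto_ofReal ?_
    have h0 : Tendsto (fun n : ℕ => x / ((n : ℝ) + 1)) atTop (𝓝 0) :=
      tendsto_const_nhds.div_atTop (tendsto_natCast_atTop_atTop.atTop_add tendsto_const_nhds)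
    have h1 : Tendsto (fun n : ℕ => h x * (1 + (x / ((n : ℝ) + 1)) ^ 2)⁻¹) atTop
        (𝓝 (h x * (1 + (0 : ℝ) ^ 2)⁻¹)) :=
      ((tendsto_const_nhds.add (h0.pow 2)).inv₀ (by norm_num)).const_mul _
    simp only [ne_eq, OfNat.ofNat_ne_zero, not_false_eq_true, zero_pow, add_zero, inv_one,
      mul_one] at h1
    refine h1.congr fun n => ?_
    rw [poissonWeight, sub_zero]
    congr 1
    field_simp
    ring
  calc _ = ∫⁻ x, liminf (fun n : ℕ => ENNReal.ofReal
        (h x * (((n : ℝ) + 1) ^ 2 * poissonWeight 0 ((n : ℝ) + 1) x))) atTop :=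
        lintegral_congr fun x => (hlim x).liminf_eq.symm
    _ ≤ liminf (fun n : ℕ => ∫⁻ x, ENNReal.ofReal
        (h x * (((n : ℝ) + 1) ^ 2 * poissonWeight 0 ((n : ℝ) + 1) x))) atTop := by
        refine lintegral_liminf_le fun n => ?_
        exact ENNReal.measurable_ofReal.comp (hcont.mul (continuous_const.mul
          (continuous_poissonWeight 0 (by positivity)))).measurable
    _ ≤ ENNReal.ofReal (Real.pi * M) := by
        refine (liminf_le_liminf (.of_forall fun n => hbound _ (by positivity))).trans_eq ?_
        exact liminf_const _

/-- The Poisson kernel at `ψ`, as a function of `ψ`, is the imaginary part of `-1 / (ψ - t)`. -/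
theorem im_neg_inv_sub (ψ : ℂ) (t : ℝ) :
    (-(ψ - t)⁻¹).im = ψ.im * poissonWeight ψ.re ψ.im t := by
  rw [Complex.neg_im, Complex.inv_im, poissonWeight, Complex.normSq_apply]
  simp only [Complex.sub_im, Complex.sub_re, Complex.ofReal_im, Complex.ofReal_re, sub_zero]
  rw [neg_div, neg_neg, div_eq_mul_inv]
  congr 2
  ring

/-- The pullback under `ψ` of the Poisson kernel with pole at `t` has total mass at most `π M`
on the line at height `y`, as soon as `ψ` moves points up at a rate at least `1 / M`. -/
theorem lintegral_poissonWeight_comp_le {ψ : ℂ → ℂ} {y M c : ℝ} (hM : 0 < M) (hc : 0 < c)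
    (hψ : DifferentiableOn ℂ ψ {z | y ≤ z.im})
    (hgrow : ∀ z : ℂ, y ≤ z.im → c + (z.im - y) / M ≤ (ψ z).im) (t : ℝ) :
    ∫⁻ x : ℝ, ENNReal.ofReal ((ψ (x + y * Complex.I)).im * poissonWeight (ψ (x + y * Complex.I)).re
      (ψ (x + y * Complex.I)).im t) ≤ ENNReal.ofReal (Real.pi * M) := by
  have hnorm : ∀ z : ℂ, (ψ z).im ≤ ‖ψ z - t‖ := fun z => by
    simpa using (le_abs_self _).trans (Complex.abs_im_le_norm (ψ z - t))
  have hge : ∀ z : ℂ, y ≤ z.im → c ≤ (ψ z).im := fun z hz =>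
    le_trans (le_add_of_nonneg_right (div_nonneg (sub_nonneg.2 hz) hM.le)) (hgrow z hz)
  have hne : ∀ z : ℂ, y ≤ z.im → ψ z - t ≠ 0 := fun z hz =>
    norm_pos_iff.1 (hc.trans_le ((hge z hz).trans (hnorm z)))
  simp_rw [← im_neg_inv_sub]
  refine lintegral_im_line_le (G := fun z => -(ψ z - t)⁻¹) (B := c⁻¹)
    ((hψ.sub_const _).inv hne).neg (fun z hz => ?_) (fun x => ?_) fun s hs => ?_
  · rw [norm_neg, norm_inv]
    exact inv_anti₀ hc ((hge z hz).trans (hnorm z))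
  · rw [im_neg_inv_sub]
    exact mul_nonneg (hc.le.trans (hge _ (by simp))) (poissonWeight_nonneg _ _ _)
  · set z : ℂ := (y + s : ℝ) * Complex.I with hz
    have hzim : z.im = y + s := by simp [hz]
    have hg := hgrow z (by linarith)
    rw [hzim, add_sub_cancel_left] at hg
    have hsM : 0 < s / M := by positivity
    have hlow : s / M ≤ ‖ψ z - t‖ := by linarith [hnorm z]
    calc s * (-(ψ z - t)⁻¹).im ≤ s * (s / M)⁻¹ := by
          gcongr
          refine (le_abs_self _).trans ((Complex.abs_im_le_norm _).trans ?_)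
          rw [norm_neg, norm_inv]
          exact inv_anti₀ hsM hlow
      _ = M := by field_simp

theorem isAnalytic_comp {f : ℍ → ℂ} (hf : IsAnalytic f) {φ : ℍ → ℍ}
    (hφ : IsAnalytic (fun z => (φ z : ℂ))) : IsAnalytic (f ∘ φ) := by
  have h := DifferentiableOn.comp hf hφ fun z _ => (φ (ofComplex z)).im_pos
  refine h.congr fun z _ => ?_
  simp [ofComplex_apply]

/-- Composition with `φ` multiplies the Hardy norm by at most `√M` when `Im z ≤ M * Im φ(z)`. -/
theorem hardyNorm_comp_le {φ : ℍ → ℍ} (hφ : IsAnalytic (fun z => (φ z : ℂ))) {M : ℝ} (hM : 0 < M)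
    (hle : ∀ z : ℍ, z.im ≤ M * (φ z).im) {f : ℍ → ℂ} (hf : f ∈ hardySpace) :
    hardyNorm (f ∘ φ) ≤ ENNReal.ofReal (√M) * hardyNorm f := by
  refine hardyNorm_le fun y hy => ?_
  -- the line from which `f` is reproduced lies strictly below the image of the line at height `y`
  set y₀ : ℝ := y / (2 * M) with hy₀
  have hy₀pos : 0 < y₀ := by positivity
  set ψ : ℂ → ℂ := fun z => (φ (ofComplex z) : ℂ) - y₀ * Complex.I with hψ
  have hψre : ∀ z, (ψ z).re = (φ (ofComplex z) : ℂ).re := fun z => by simp [hψ]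
  have hψim : ∀ z, (ψ z).im = (φ (ofComplex z) : ℂ).im - y₀ := fun z => by simp [hψ]
  have hψd : DifferentiableOn ℂ ψ {z | y ≤ z.im} := (differentiableOn_closed hφ hy).sub_const _
  have hgrow : ∀ z : ℂ, y ≤ z.im → y₀ + (z.im - y) / M ≤ (ψ z).im := by
    intro z hz
    have h := hle (ofComplex z)
    have hz' : (ofComplex z).im = z.im := by
      rw [ofComplex_apply_of_im_pos (hy.trans_le hz)]
      rfl
    rw [hz', ← coe_im, ← div_le_iff₀' hM] at h
    rw [hψim]
    refine le_trans (le_of_eq ?_) (sub_le_sub_right h y₀)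
    rw [hy₀]
    field_simp
    ring
  have hcψ : Continuous fun x : ℝ => ψ (x + y * Complex.I) := continuous_line hψd
  have hψpos : ∀ x : ℝ, 0 < (ψ (x + y * Complex.I)).im := fun x =>
    hy₀pos.trans_le (by simpa using hgrow (x + y * Complex.I) (by simp))
  have hmaj : ∀ x : ℝ, ‖slice (f ∘ φ) y x‖ₑ ^ 2 ≤ ∫⁻ t : ℝ, ENNReal.ofReal Real.pi⁻¹ *
      (‖slice f y₀ t‖ₑ ^ 2 * ENNReal.ofReal ((ψ (x + y * Complex.I)).im *
        poissonWeight (ψ (x + y * Complex.I)).re (ψ (x + y * Complex.I)).im t)) := by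
    intro x
    have h := enorm_sq_le_lintegral_poisson hf hy₀pos
      (p := (φ (ofComplex (x + y * Complex.I)) : ℂ)) (sub_pos.1 (by simpa [hψim] using hψpos x))
    rw [ofComplex_apply] at h
    simp_rw [hψre, hψim]
    exact h
  have hmeas : Measurable fun q : ℝ × ℝ => ENNReal.ofReal Real.pi⁻¹ *
      (‖slice f y₀ q.2‖ₑ ^ 2 * ENNReal.ofReal ((ψ (q.1 + y * Complex.I)).im *
        poissonWeight (ψ (q.1 + y * Complex.I)).re (ψ (q.1 + y * Complex.I)).im q.2)) := by
    have h1 : Continuous fun q : ℝ × ℝ => slice f y₀ q.2 :=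
      (slice_continuous hf.1 hy₀pos).comp continuous_snd
    have h2 : Continuous fun q : ℝ × ℝ => ψ (q.1 + y * Complex.I) := hcψ.comp continuous_fst
    have h3 : Continuous fun q : ℝ × ℝ => (ψ (q.1 + y * Complex.I)).im *
        poissonWeight (ψ (q.1 + y * Complex.I)).re (ψ (q.1 + y * Complex.I)).im q.2 := by
      unfold poissonWeight
      refine (Complex.continuous_im.comp h2).mul (Continuous.inv₀ ?_ fun q => ?_)
      · exact ((continuous_snd.sub (Complex.continuous_re.comp h2)).pow 2).add
          ((Complex.continuous_im.comp h2).pow 2)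
      · have := hψpos q.1
        positivity
    exact measurable_const.mul ((h1.measurable.enorm.pow_const 2).mul
      (ENNReal.measurable_ofReal.comp h3.measurable))
  calc _ ≤ ∫⁻ x : ℝ, ∫⁻ t : ℝ, ENNReal.ofReal Real.pi⁻¹ *
        (‖slice f y₀ t‖ₑ ^ 2 * ENNReal.ofReal ((ψ (x + y * Complex.I)).im *
          poissonWeight (ψ (x + y * Complex.I)).re (ψ (x + y * Complex.I)).im t)) :=
        lintegral_mono hmaj
    _ = ∫⁻ t : ℝ, ∫⁻ x : ℝ, ENNReal.ofReal Real.pi⁻¹ *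
        (‖slice f y₀ t‖ₑ ^ 2 * ENNReal.ofReal ((ψ (x + y * Complex.I)).im *
          poissonWeight (ψ (x + y * Complex.I)).re (ψ (x + y * Complex.I)).im t)) :=
        lintegral_lintegral_swap hmeas.aemeasurable
    _ ≤ ∫⁻ t : ℝ, ENNReal.ofReal Real.pi⁻¹ *
        (‖slice f y₀ t‖ₑ ^ 2 * ENNReal.ofReal (Real.pi * M)) := by
        refine lintegral_mono fun t => ?_
        dsimp only
        rw [lintegral_const_mul' _ _ ENNReal.ofReal_ne_top,
          lintegral_const_mul' _ _ (by finiteness)]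
        gcongr
        exact lintegral_poissonWeight_comp_le hM hy₀pos hψd hgrow t
    _ = ENNReal.ofReal M * ∫⁻ t : ℝ, ‖slice f y₀ t‖ₑ ^ 2 := by
        rw [lintegral_const_mul' _ _ ENNReal.ofReal_ne_top,
          lintegral_mul_const' _ _ ENNReal.ofReal_ne_top, mul_left_comm,
          ← ENNReal.ofReal_mul (by positivity), inv_mul_cancel_left₀ Real.pi_ne_zero, mul_comm]
    _ ≤ ENNReal.ofReal M * hardyNorm f ^ 2 := by
        gcongr
        exact lintegral_slice_sq_le f hy₀pos
    _ = (ENNReal.ofReal (√M) * hardyNorm f) ^ 2 := by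
        rw [mul_pow, ← ENNReal.ofReal_pow (Real.sqrt_nonneg M), Real.sq_sqrt hM.le]

theorem compBounded_of_bddAbove {φ : ℍ → ℍ} (hφ : IsAnalytic (fun z => (φ z : ℂ)))
    (hbdd : BddAbove (Set.range fun z : ℍ => z.im / (φ z).im)) {V : Submodule ℂ (ℍ → ℂ)}
    (hV : V ≤ hardySpace) : CompBounded V φ := by
  obtain ⟨M, hM⟩ := hbdd
  have hle : ∀ z : ℍ, z.im / (φ z).im ≤ M := fun z => hM ⟨z, rfl⟩
  have hMpos : 0 < M := lt_of_lt_of_le (div_pos I.im_pos (φ I).im_pos) (hle I)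
  have hnorm := fun f hf => hardyNorm_comp_le (f := f) hφ hMpos
    (fun z => (div_le_iff₀ (φ z).im_pos).1 (hle z)) hf
  exact ⟨(√M).toNNReal, fun f hf => ⟨⟨isAnalytic_comp (hV hf).1 hφ,
    (hnorm f (hV hf)).trans_lt (ENNReal.mul_lt_top ENNReal.ofReal_lt_top (hV hf).2)⟩,
    hnorm f (hV hf)⟩⟩

/-! ### The reproducing kernels of the model space -/

/-- The reproducing kernel of the model space at `w`, up to the constant factor `i / (2 π)`. -/
noncomputable def modelKernel (χ : ℍ → ℂ) (w : ℍ) : ℍ → ℂ :=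
  fun z => (1 - conj (χ w) * χ z) / ((z : ℂ) - conj (w : ℂ))

theorem integral_line_re_mul_poissonWeight {F : ℂ → ℂ} {y B : ℝ} {p : ℂ} (hp : y < p.im)
    (hF : DifferentiableOn ℂ F {z | y ≤ z.im}) (hB : ∀ z : ℂ, y ≤ z.im → ‖F z‖ ≤ B) :
    Integrable (fun x : ℝ => (F (x + y * Complex.I)).re * poissonWeight p.re (p.im - y) x) ∧
    ∫ x : ℝ, (F (x + y * Complex.I)).re * poissonWeight p.re (p.im - y) x =
      Real.pi / (p.im - y) * (F p).re := by
  have hint := integrable_mul_poissonWeight (continuous_line hF) (fun x => hB _ (by simp))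
    p.re (sub_pos.2 hp)
  have hre : ∀ x : ℝ, (F (x + y * Complex.I) * (poissonWeight p.re (p.im - y) x : ℝ)).re =
      (F (x + y * Complex.I)).re * poissonWeight p.re (p.im - y) x :=
    fun x => Complex.re_mul_ofReal _ _
  refine ⟨hint.re.congr (.of_forall hre), ?_⟩
  rw [← Complex.re_ofReal_mul, ← integral_line_mul_poissonWeight hp hF hB]
  refine Eq.trans ?_ (integral_re (𝕜 := ℂ) hint)
  exact integral_congr_ae (.of_forall fun x => (hre x).symm)

/-- Harnack's inequality on a vertical ray, from the comparison of the Poisson kernels on the line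
halfway between `p` and the real axis. -/
theorem harnack_vertical {F : ℂ → ℂ} {B : ℝ} (hF : DifferentiableOn ℂ F {z | 0 < z.im})
    (hB : ∀ z : ℂ, 0 < z.im → ‖F z‖ ≤ B) (hpos : ∀ z : ℂ, 0 < z.im → 0 ≤ (F z).re)
    {p q : ℂ} (hp : 0 < p.im) (hre : q.re = p.re) (him : p.im ≤ q.im) :
    (F q).re ≤ 2 * q.im / p.im * (F p).re := by
  have hy : 0 < p.im / 2 := by positivity
  have hF' : DifferentiableOn ℂ F {z | p.im / 2 ≤ z.im} :=
    hF.mono fun z (hz : p.im / 2 ≤ z.im) => hy.trans_le hz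
  have hB' : ∀ z : ℂ, p.im / 2 ≤ z.im → ‖F z‖ ≤ B := fun z hz => hB z (hy.trans_le hz)
  obtain ⟨hip, hPp⟩ := integral_line_re_mul_poissonWeight (half_lt_self hp) hF' hB'
  obtain ⟨hiq, hPq⟩ := integral_line_re_mul_poissonWeight ((half_lt_self hp).trans_le him) hF' hB'
  have hppos : 0 < p.im - p.im / 2 := by linarith
  have hqpos : 0 < q.im - p.im / 2 := by linarith
  have hle : Real.pi / (q.im - p.im / 2) * (F q).re ≤ Real.pi / (p.im - p.im / 2) * (F p).re := by
    rw [← hPq, ← hPp]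
    refine integral_mono hiq hip fun x => ?_
    refine mul_le_mul_of_nonneg_left ?_ (hpos _ (by simpa using hy))
    unfold poissonWeight
    rw [hre]
    gcongr
  rw [div_mul_eq_mul_div, div_mul_eq_mul_div, div_le_div_iff₀ hqpos hppos] at hle
  have hFp := hpos p hp
  have hle' : (F q).re * (p.im / 2) ≤ (F p).re * (q.im - p.im / 2) := by
    refine le_of_mul_le_mul_left ?_ Real.pi_pos
    linarith
  rw [div_mul_eq_mul_div, le_div_iff₀ hp]
  nlinarith

theorem poissonWeight_abs (a s : ℝ) : poissonWeight a |s| = poissonWeight a s := by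
  ext x
  rw [poissonWeight, poissonWeight, sq_abs]

theorem poissonWeight_eq_norm_sub_conj (w : ℂ) (y x : ℝ) :
    poissonWeight w.re (w.im + y) x = (‖(x : ℂ) + y * Complex.I - conj w‖ ^ 2)⁻¹ := by
  rw [← poissonWeight_eq_norm, Complex.conj_re, Complex.conj_im, ← poissonWeight_abs,
    ← poissonWeight_abs _ (-w.im - y), ← abs_neg (-w.im - y)]
  congr 2
  ring

theorem memLp_cauchyKernel {p : ℂ} {y : ℝ} (hp : p.im ≠ y) :
    MemLp (fun x : ℝ => ((x : ℂ) + y * Complex.I - p)⁻¹) 2 volume := by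
  have hne : ∀ x : ℝ, (x : ℂ) + y * Complex.I - p ≠ 0 := fun x h => hp (by
    have := congrArg Complex.im h
    simp at this
    linarith)
  have hc : Continuous fun x : ℝ => ((x : ℂ) + y * Complex.I - p)⁻¹ :=
    Continuous.inv₀ (by fun_prop) hne
  refine (memLp_two_iff_integrable_sq_norm hc.aestronglyMeasurable).2 ?_
  refine (integrable_poissonWeight p.re (abs_pos.2 (sub_ne_zero.2 hp))).congr
    (.of_forall fun x => ?_)
  dsimp only
  rw [poissonWeight_abs, poissonWeight_eq_norm, norm_inv, inv_pow]

theorem norm_modelKernel_apply_self (χ : ℍ → ℂ) (w : ℍ) :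
    ‖modelKernel χ w w‖ = |1 - ‖χ w‖ ^ 2| / (2 * w.im) := by
  have h1 : (w : ℂ) - conj (w : ℂ) = ((2 * w.im : ℝ) : ℂ) * Complex.I := by
    rw [Complex.sub_conj, coe_im]
  have h2 : 1 - conj (χ w) * χ w = ((1 - ‖χ w‖ ^ 2 : ℝ) : ℂ) := by
    rw [Complex.conj_mul']
    push_cast
    ring
  rw [modelKernel, h1, h2, norm_div, norm_mul, Complex.norm_I, mul_one, Complex.norm_real,
    Complex.norm_real, Real.norm_eq_abs, Real.norm_of_nonneg (by positivity)]

theorem isAnalytic_modelKernel {χ : ℍ → ℂ} (hχ : IsInner χ) (w : ℍ) :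
    IsAnalytic (modelKernel χ w) := by
  have h : DifferentiableOn ℂ (fun z : ℂ => (1 - conj (χ w) * χ (ofComplex z)) /
      (z - conj (w : ℂ))) {z | 0 < z.im} := by
    refine ((hχ.analytic.const_mul _).const_sub 1).div (by fun_prop) fun z hz h => ?_
    have hz' : 0 < z.im := hz
    rw [sub_eq_zero] at h
    rw [h, Complex.conj_im, coe_im] at hz'
    linarith [w.im_pos]
  refine h.congr fun z hz => ?_
  simp only [modelKernel, ofComplex_apply_of_im_pos hz]

/-- The bound `‖k_w‖² ≤ 8 π (1 - |χ(w)|²) / Im w`.  On the line at height `y` the squared modulus of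
the kernel is a Poisson kernel for `w + 2 i y` times `|1 - F|²`, where `F = conj (χ w) * χ`, and
`|1 - F|² ≤ 2 Re (1 - F)`.  By the Poisson formula the integral is controlled by the value of
`Re (1 - F)` at `w + 2 i y`, and by Harnack's inequality by its value `1 - |χ(w)|²` at `w`. -/
theorem hardyNorm_modelKernel_le {χ : ℍ → ℂ} (hχ : IsInner χ) (w : ℍ) :
    hardyNorm (modelKernel χ w) ≤
      ENNReal.ofReal (√(8 * Real.pi * (1 - ‖χ w‖ ^ 2) / w.im)) := by
  have hv : 0 < (w : ℂ).im := w.im_pos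
  set F : ℂ → ℂ := fun z => 1 - conj (χ w) * χ (ofComplex z) with hF
  have hFd : DifferentiableOn ℂ F {z | 0 < z.im} := (hχ.analytic.const_mul _).const_sub 1
  have hprod : ∀ z, ‖conj (χ w) * χ z‖ ≤ 1 := fun z => by
    rw [norm_mul, RCLike.norm_conj]
    exact mul_le_one₀ (hχ.norm_le_one w) (norm_nonneg _) (hχ.norm_le_one z)
  have hFB : ∀ z, ‖F z‖ ≤ 2 := fun z => by
    refine (norm_sub_le _ _).trans ?_
    rw [norm_one]
    linarith [hprod (ofComplex z)]
  have hsq : ∀ z, ‖F z‖ ^ 2 ≤ 2 * (F z).re := fun z => by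
    have h := hprod (ofComplex z)
    have h2 : Complex.normSq (conj (χ w) * χ (ofComplex z)) ≤ 1 := by
      rw [Complex.normSq_eq_norm_sq]
      exact pow_le_one₀ (norm_nonneg _) h
    rw [← Complex.normSq_eq_norm_sq]
    simp only [hF, Complex.normSq_sub, Complex.sub_re, Complex.one_re, map_one, one_mul,
      Complex.conj_re]
    linarith
  have hpos : ∀ z, 0 ≤ (F z).re := fun z => by linarith [hsq z, sq_nonneg ‖F z‖]
  have hFw : (F w).re = 1 - ‖χ w‖ ^ 2 := by
    simp only [hF, ofComplex_apply, Complex.conj_mul', ← Complex.ofReal_pow, Complex.sub_re,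
      Complex.one_re, Complex.ofReal_re]
  have hD : 0 ≤ 1 - ‖χ w‖ ^ 2 := hFw ▸ hpos w
  refine hardyNorm_le fun y hy => ?_
  set q : ℂ := (w : ℂ) + (2 * y : ℝ) * Complex.I with hq
  have hqre : q.re = (w : ℂ).re := by simp [hq]
  have hqim : q.im = (w : ℂ).im + 2 * y := by simp [hq]
  have hqy : q.im - y = (w : ℂ).im + y := by rw [hqim]; ring
  obtain ⟨hint, hP⟩ := integral_line_re_mul_poissonWeight (F := F) (p := q) (by linarith)
    (hFd.mono fun z (hz : y ≤ z.im) => hy.trans_le hz) fun z _ => hFB z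
  have hH := harnack_vertical hFd (fun z _ => hFB z) (fun z _ => hpos z) hv hqre (by linarith)
  have hpt : ∀ x : ℝ, ‖slice (modelKernel χ w) y x‖ₑ ^ 2 ≤ ENNReal.ofReal
      (2 * ((F (x + y * Complex.I)).re * poissonWeight q.re (q.im - y) x)) := by
    intro x
    have him : 0 < ((x : ℂ) + y * Complex.I).im := by simpa using hy
    rw [← ofReal_norm, ← ENNReal.ofReal_pow (norm_nonneg _)]
    refine ENNReal.ofReal_le_ofReal ?_
    have hval : slice (modelKernel χ w) y x = F (x + y * Complex.I) /
        ((x : ℂ) + y * Complex.I - conj (w : ℂ)) := by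
      simp only [slice, modelKernel, hF, ofComplex_apply_of_im_pos him]
    rw [hval, hqre, hqy, poissonWeight_eq_norm_sub_conj, norm_div, div_pow, div_eq_mul_inv,
      ← mul_assoc]
    gcongr
    exact hsq _
  calc _ ≤ ∫⁻ x : ℝ, ENNReal.ofReal
        (2 * ((F (x + y * Complex.I)).re * poissonWeight q.re (q.im - y) x)) := lintegral_mono hpt
    _ = ENNReal.ofReal (2 * (Real.pi / ((w : ℂ).im + y) * (F q).re)) := by
        rw [← ofReal_integral_eq_lintegral_ofReal (hint.const_mul _) (.of_forall fun x =>
          mul_nonneg zero_le_two (mul_nonneg (hpos _) (poissonWeight_nonneg _ _ _))),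
          integral_const_mul, hP, hqy]
    _ ≤ ENNReal.ofReal (8 * Real.pi * (1 - ‖χ w‖ ^ 2) / (w : ℂ).im) := by
        refine ENNReal.ofReal_le_ofReal ?_
        rw [hFw, hqim] at hH
        calc _ ≤ 2 * (Real.pi / ((w : ℂ).im + y) *
              (2 * (2 * ((w : ℂ).im + y)) / (w : ℂ).im * (1 - ‖χ w‖ ^ 2))) := by
              gcongr
              refine hH.trans ?_
              gcongr
              linarith
          _ = _ := by
              field_simp
              ring
    _ = _ := by
        rw [← ENNReal.ofReal_pow (Real.sqrt_nonneg _), Real.sq_sqrt]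
        · rfl
        · have := w.im_pos
          positivity

theorem modelKernel_mem_hardySpace {χ : ℍ → ℂ} (hχ : IsInner χ) (w : ℍ) :
    modelKernel χ w ∈ hardySpace :=
  ⟨isAnalytic_modelKernel hχ w, (hardyNorm_modelKernel_le hχ w).trans_lt ENNReal.ofReal_lt_top⟩

/-! ### Orthogonality of the kernels to the multiples of the inner function -/

theorem le_norm_one_sub_I_mul {δ : ℝ} (hδ : 0 ≤ δ) {z : ℂ} (hz : 0 ≤ z.im) :
    1 ≤ ‖1 - Complex.I * (δ * z)‖ ∧ δ * ‖z‖ ≤ ‖1 - Complex.I * (δ * z)‖ := by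
  have hδz : 0 ≤ δ * z.im := mul_nonneg hδ hz
  have hsq : ‖1 - Complex.I * (δ * z)‖ ^ 2 = (1 + δ * z.im) ^ 2 + (δ * z.re) ^ 2 := by
    rw [← Complex.normSq_eq_norm_sq, Complex.normSq_apply]
    simp
    ring
  constructor <;> refine le_of_sq_le_sq ?_ (norm_nonneg _)
  · rw [hsq]
    nlinarith [sq_nonneg (δ * z.re)]
  · rw [hsq, mul_pow, ← Complex.normSq_eq_norm_sq, Complex.normSq_apply]
    nlinarith

/-- The difference quotient of a bounded analytic function annihilates the Hardy space: the Cauchy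
theorem `integral_line_slope_mul_eq_zero` applies to `g` times the factor `(1 - i δ z)⁻¹`, which
supplies the missing decay and tends to `1` boundedly as `δ → 0`. -/
theorem integral_slope_mul_slice_eq_zero {F : ℂ → ℂ} {y B : ℝ} {p : ℂ} (hy : 0 < y)
    (hp : y < p.im) (hF : DifferentiableOn ℂ F {z | y ≤ z.im})
    (hB : ∀ z : ℂ, y ≤ z.im → ‖F z‖ ≤ B) {g : ℍ → ℂ} (hg : g ∈ hardySpace) :
    Integrable (fun x : ℝ => (F (x + y * Complex.I) - F p) / (x + y * Complex.I - p) *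
      slice g y x) ∧
    ∫ x : ℝ, (F (x + y * Complex.I) - F p) / (x + y * Complex.I - p) * slice g y x = 0 := by
  have hFc := continuous_line hF
  have hκ := memLp_cauchyKernel hp.ne'
  have hS : MemLp (fun x : ℝ => (F (x + y * Complex.I) - F p) / (x + y * Complex.I - p)) 2
      volume := by
    refine (hκ.const_mul (2 * B : ℂ)).of_le
      ((hFc.sub continuous_const).aestronglyMeasurable.mul hκ.1) (.of_forall fun x => ?_)
    have h0 : 0 ≤ B := (norm_nonneg _).trans (hB p hp.le)
    have h1 : ‖F (x + y * Complex.I) - F p‖ ≤ 2 * B :=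
      (norm_sub_le _ _).trans (by linarith [hB (x + y * Complex.I) (by simp), hB p hp.le])
    rw [div_eq_mul_inv, norm_mul, norm_mul]
    gcongr
    simpa [abs_of_nonneg h0] using h1
  have hint : Integrable (fun x : ℝ => (F (x + y * Complex.I) - F p) / (x + y * Complex.I - p) *
      slice g y x) := hS.integrable_mul (slice_memLp hg hy)
  refine ⟨hint, ?_⟩
  obtain ⟨Bg, hBg⟩ := exists_norm_le_of_mem_hardySpace hg hy
  set δ : ℕ → ℝ := fun n => 1 / ((n : ℝ) + 1) with hδ
  have hδpos : ∀ n, 0 < δ n := fun n => by positivity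
  set m : ℕ → ℂ → ℂ := fun n z => (1 - Complex.I * (δ n * z))⁻¹ with hm
  have hm1 : ∀ (n : ℕ) (z : ℂ), y ≤ z.im → 1 ≤ ‖1 - Complex.I * (δ n * z)‖ := fun n z hz =>
    (le_norm_one_sub_I_mul (hδpos n).le (hy.le.trans hz)).1
  have hmdecay : ∀ (n : ℕ) (z : ℂ), y ≤ z.im → δ n * ‖z‖ ≤ ‖1 - Complex.I * (δ n * z)‖ :=
    fun n z hz => (le_norm_one_sub_I_mul (hδpos n).le (hy.le.trans hz)).2
  have hmle : ∀ (n : ℕ) (z : ℂ), y ≤ z.im → ‖m n z‖ ≤ 1 := fun n z hz => by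
    rw [hm, norm_inv]
    exact inv_le_one_of_one_le₀ (hm1 n z hz)
  have hmd : ∀ n : ℕ, DifferentiableOn ℂ (m n) {z | y ≤ z.im} := fun n =>
    DifferentiableOn.inv (by fun_prop) fun z hz =>
      norm_pos_iff.1 (one_pos.trans_le (hm1 n z hz))
  set I₀ : ℝ → ℂ := fun x => (F (x + y * Complex.I) - F p) / (x + y * Complex.I - p) *
    slice g y x with hI₀
  have hmc : ∀ n, Continuous fun x : ℝ => m n (x + y * Complex.I) := fun n =>
    continuous_line (hmd n)
  have hzero : ∀ n : ℕ, ∫ x : ℝ, m n (x + y * Complex.I) * I₀ x = 0 := by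
    intro n
    have hcomm : ∀ x : ℝ, m n (x + y * Complex.I) * I₀ x =
        (F (x + y * Complex.I) - F p) / (x + y * Complex.I - p) *
          (fun z => g (ofComplex z) * m n z) (x + y * Complex.I) := fun x => by
      simp only [hI₀, slice]
      ring
    have hint' : Integrable fun x : ℝ => m n (x + y * Complex.I) * I₀ x :=
      hint.bdd_mul (hmc n).aestronglyMeasurable (.of_forall fun x => hmle n _ (by simp))
    simp_rw [hcomm] at hint' ⊢
    refine integral_line_slope_mul_eq_zero (C := Bg / δ n) (R₀ := 1) hp hF hB
      ((differentiableOn_closed hg.1 hy).mul (hmd n)) (fun z hz hz1 => ?_) hint'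
    have hzpos : 0 < ‖z‖ := by linarith
    have hBg0 : 0 ≤ Bg := (norm_nonneg _).trans (hBg z hz)
    rw [Pi.mul_apply, norm_mul, div_div, div_eq_mul_inv]
    refine mul_le_mul (hBg z hz) ?_ (norm_nonneg _) hBg0
    rw [hm, norm_inv]
    exact inv_anti₀ (mul_pos (hδpos n) hzpos) (hmdecay n z hz)
  have hlim : Tendsto (fun n : ℕ => ∫ x : ℝ, m n (x + y * Complex.I) * I₀ x) atTop
      (𝓝 (∫ x, I₀ x)) := by
    refine tendsto_integral_of_dominated_convergence (fun x => ‖I₀ x‖)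
      (fun n => (hmc n).aestronglyMeasurable.mul hint.1) hint.norm
      (fun n => .of_forall fun x => ?_) (.of_forall fun x => ?_)
    · rw [norm_mul]
      exact mul_le_of_le_one_left (norm_nonneg _) (hmle n _ (by simp))
    · have hδ0 : Tendsto (fun n : ℕ => (δ n : ℂ)) atTop (𝓝 ((0 : ℝ) : ℂ)) :=
        (Complex.continuous_ofReal.tendsto _).comp tendsto_one_div_add_atTop_nhds_zero_nat
      have h1 : Tendsto (fun n : ℕ => m n (x + y * Complex.I) * I₀ x) atTop
          (𝓝 ((1 - Complex.I * (((0 : ℝ) : ℂ) * ((x : ℂ) + y * Complex.I)))⁻¹ * I₀ x)) := by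
        refine Tendsto.mul_const _ (Tendsto.inv₀ ?_ (by simp))
        exact tendsto_const_nhds.sub ((hδ0.mul_const _).const_mul _)
      simpa using h1
  exact tendsto_nhds_unique hlim (by simp only [hzero, tendsto_const_nhds])

theorem enorm_integral_mul_conj_le {f g : ℝ → ℂ} (hf : AEStronglyMeasurable f)
    (hg : AEStronglyMeasurable g) :
    ‖∫ x, f x * conj (g x)‖ₑ ≤ (∫⁻ x, ‖f x‖ₑ ^ 2) ^ (1 / 2 : ℝ) * eLpNorm g 2 volume := by
  refine (enorm_integral_le_lintegral_enorm _).trans ?_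
  have h := ENNReal.lintegral_mul_le_Lp_mul_Lq volume Real.HolderConjugate.two_two
    hf.enorm hg.enorm
  have h2 : eLpNorm g 2 volume = (∫⁻ x, ‖g x‖ₑ ^ (2 : ℝ)) ^ (1 / 2 : ℝ) := by
    simp [eLpNorm_eq_lintegral_rpow_enorm_toReal]
  rw [h2]
  simpa [enorm_mul, RCLike.enorm_conj] using h

/-- The kernels are orthogonal to `χ g`.  With `b = χ(w + 2 i y)` one has, on the line at height `y`,
`conj χ * (1 - conj a * χ) = conj (χ - b) + (conj (b - a) + conj a * (1 - |χ|²))`, where `a = χ(w)`.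
The first term integrates to zero by Cauchy's theorem; the second tends to zero as `y → 0`,
boundedly and almost everywhere, since `|χ| = 1` on the real line. -/
theorem hasHardyInner_modelKernel {χ : ℍ → ℂ} (hχ : IsInner χ) (w : ℍ) {g : ℍ → ℂ}
    (hg : g ∈ hardySpace) : HasHardyInner (modelKernel χ w) (χ * g) 0 := by
  have hv : 0 < (w : ℂ).im := w.im_pos
  set F : ℂ → ℂ := fun z => χ (ofComplex z) with hF
  have hFB : ∀ z, ‖F z‖ ≤ 1 := fun z => hχ.norm_le_one _
  have hFw : F w = χ w := by simp only [hF, ofComplex_apply]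
  set q : ℝ → ℂ := fun y => (w : ℂ) + (2 * y : ℝ) * Complex.I with hq
  set E : ℝ → ℝ → ℂ := fun y x => (conj (F (q y) - F w) +
    conj (F w) * (1 - (‖slice χ y x‖ : ℂ) ^ 2)) with hE
  set κ : ℝ → ℝ → ℂ := fun y x => ((x : ℂ) + y * Complex.I - conj (w : ℂ))⁻¹ with hκdef
  have hκ : ∀ y, 0 < y → MemLp (κ y) 2 volume := fun y hy =>
    memLp_cauchyKernel (by rw [Complex.conj_im]; linarith)
  have hEm : ∀ y, 0 < y → AEStronglyMeasurable (E y) := fun y hy => by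
    have := slice_continuous hχ.analytic hy
    exact (by fun_prop : Continuous (E y)).aestronglyMeasurable
  have hEle : ∀ y x, ‖E y x‖ ≤ 3 := by
    intro y x
    have h1 : ‖F (q y) - F w‖ ≤ 2 := (norm_sub_le _ _).trans (by linarith [hFB (q y), hFB w])
    have hs : ‖slice χ y x‖ ≤ 1 := hχ.norm_le_one _
    have h2 : ‖(1 - (‖slice χ y x‖ : ℂ) ^ 2)‖ ≤ 1 := by
      have : (1 - (‖slice χ y x‖ : ℂ) ^ 2) = ((1 - ‖slice χ y x‖ ^ 2 : ℝ) : ℂ) := by push_cast; rfl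
      rw [this, Complex.norm_real, Real.norm_eq_abs, abs_le]
      constructor <;> nlinarith [norm_nonneg (slice χ y x)]
    refine (norm_add_le _ _).trans ?_
    rw [norm_mul, RCLike.norm_conj, RCLike.norm_conj]
    nlinarith [norm_nonneg (F w), hFB w, norm_nonneg (1 - (‖slice χ y x‖ : ℂ) ^ 2)]
  have hκE : ∀ y, 0 < y → MemLp (fun x => E y x * κ y x) 2 volume := fun y hy =>
    ((hκ y hy).const_mul (3 : ℂ)).of_le ((hEm y hy).mul (hκ y hy).1) (.of_forall fun x => by
      rw [norm_mul, norm_mul]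
      gcongr
      simpa using hEle y x)
  have hred : ∀ y, 0 < y →
      ∫ x : ℝ, slice (modelKernel χ w) y x * conj (slice (χ * g) y x) =
        ∫ x : ℝ, E y x * κ y x * conj (slice g y x) := by
    intro y hy
    have hqim : (q y).im = (w : ℂ).im + 2 * y := by simp [hq]
    obtain ⟨hi, h0⟩ := integral_slope_mul_slice_eq_zero (F := F) (p := q y) hy (by linarith)
      (differentiableOn_closed hχ.analytic hy) (fun z _ => hFB z) hg
    have hi2 := (hκE y hy).integrable_mul (slice_memLp hg hy).star
    have hsplit : ∀ x : ℝ, slice (modelKernel χ w) y x * conj (slice (χ * g) y x) =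
        conj ((F (x + y * Complex.I) - F (q y)) / (x + y * Complex.I - q y) * slice g y x) +
          E y x * κ y x * conj (slice g y x) := by
      intro x
      have him : 0 < ((x : ℂ) + y * Complex.I).im := by simpa using hy
      have hsl : slice (modelKernel χ w) y x = (1 - conj (F w) * slice χ y x) * κ y x := by
        simp only [slice, modelKernel, hκdef, hFw, ofComplex_apply_of_im_pos him, div_eq_mul_inv]
      have hmul : slice (χ * g) y x = slice χ y x * slice g y x := rfl
      have hline : F (x + y * Complex.I) = slice χ y x := rfl
      have hconj : conj ((x : ℂ) + y * Complex.I - q y) = x + y * Complex.I - conj (w : ℂ) := by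
        apply Complex.ext <;> simp [hq]
        ring
      rw [hsl, hmul, hline, map_mul, map_mul, map_div₀, hconj, div_eq_mul_inv]
      simp only [hE, hκdef, ← Complex.conj_mul', map_sub]
      ring
    have hi' : Integrable fun x : ℝ => conj ((F (x + y * Complex.I) - F (q y)) /
        (x + y * Complex.I - q y) * slice g y x) :=
      (Complex.conjCLE.toContinuousLinearMap.integrable_comp hi)
    simp_rw [hsplit]
    refine (integral_add hi' hi2).trans ?_
    rw [integral_conj, h0, map_zero, zero_add]
    rfl
  have hEcont : ∀ᵐ x : ℝ, Tendsto (fun y => ‖E y x * κ y x‖ₑ ^ 2) (𝓝[>] 0) (𝓝 0) := by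
    have hFq : Tendsto (fun y => F (q y)) (𝓝[>] 0) (𝓝 (F w)) := by
      have hc : ContinuousAt F w :=
        (hχ.analytic.differentiableAt ((isOpen_lt continuous_const
          Complex.continuous_im).mem_nhds hv)).continuousAt
      have hq0 : Tendsto q (𝓝[>] 0) (𝓝 (w : ℂ)) := by
        have : Tendsto q (𝓝 0) (𝓝 (q 0)) := (by fun_prop : Continuous q).tendsto 0
        rw [show q 0 = w by simp [hq]] at this
        exact this.mono_left nhdsWithin_le_nhds
      exact hc.tendsto.comp hq0
    filter_upwards [hχ.boundary] with x ⟨ζ, hζ, hlim⟩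
    have hE0 : Tendsto (fun y => E y x) (𝓝[>] 0) (𝓝 0) := by
      have h1 : Tendsto (fun y => E y x) (𝓝[>] 0)
          (𝓝 (conj (F w - F w) + conj (F w) * (1 - (‖ζ‖ : ℂ) ^ 2))) := by
        refine Tendsto.add ((Complex.continuous_conj.tendsto _).comp (hFq.sub_const _))
          (Tendsto.const_mul _ (tendsto_const_nhds.sub (Tendsto.pow ?_ 2)))
        exact (Complex.continuous_ofReal.tendsto _).comp hlim.norm
      simpa [hζ] using h1
    have hκ0 : Tendsto (fun y => κ y x) (𝓝[>] 0) (𝓝 (κ 0 x)) := by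
      have hc : ContinuousAt (fun y => κ y x) 0 := by
        refine ContinuousAt.inv₀ (by fun_prop) fun h => ?_
        have := congrArg Complex.im h
        simp at this
        exact w.im_ne_zero this
      exact hc.tendsto.mono_left nhdsWithin_le_nhds
    have h := ENNReal.Tendsto.pow (n := 2) (hE0.mul hκ0).enorm
    simpa using h
  have hsq : Tendsto (fun y => ∫⁻ x, ‖E y x * κ y x‖ₑ ^ 2) (𝓝[>] 0) (𝓝 0) := by
    have h := tendsto_lintegral_filter_of_dominated_convergence' (μ := volume) (l := 𝓝[>] (0 : ℝ))
      (F := fun y x => ‖E y x * κ y x‖ₑ ^ 2) (f := fun _ => 0)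
      (fun x => ENNReal.ofReal (9 * poissonWeight (w : ℂ).re (w : ℂ).im x)) ?_ ?_ ?_ hEcont
    · simpa using h
    · filter_upwards [self_mem_nhdsWithin] with y hy
      exact (hκE y hy).1.enorm.pow_const 2
    · filter_upwards [self_mem_nhdsWithin] with y hy
      have hy' : 0 < y := hy
      refine .of_forall fun x => ?_
      rw [← ofReal_norm, ← ENNReal.ofReal_pow (norm_nonneg _), norm_mul, mul_pow]
      refine ENNReal.ofReal_le_ofReal (mul_le_mul ?_ ?_ (sq_nonneg _) (by norm_num))
      · nlinarith [hEle y x, norm_nonneg (E y x)]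
      · rw [hκdef, norm_inv, inv_pow, ← poissonWeight_eq_norm_sub_conj]
        unfold poissonWeight
        gcongr
        linarith
    · exact (((integrable_poissonWeight _ hv).const_mul 9).lintegral_lt_top).ne
  rw [HasHardyInner, tendsto_zero_iff_enorm_tendsto_zero]
  have hfin : hardyNorm g ≠ ∞ := hg.2.ne
  have hupper : Tendsto (fun y => (∫⁻ x, ‖E y x * κ y x‖ₑ ^ 2) ^ (1 / 2 : ℝ) * hardyNorm g)
      (𝓝[>] 0) (𝓝 0) := by
    have h1 := (ENNReal.continuous_rpow_const (y := (1 / 2 : ℝ))).tendsto 0 |>.comp hsq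
    rw [ENNReal.zero_rpow_of_pos (by norm_num)] at h1
    simpa using ENNReal.Tendsto.mul_const h1 (.inr hfin)
  refine tendsto_of_tendsto_of_tendsto_of_le_of_le' tendsto_const_nhds hupper
    (.of_forall fun _ => zero_le) ?_
  filter_upwards [self_mem_nhdsWithin] with y hy
  have hy' : 0 < y := hy
  rw [hred y hy']
  refine (enorm_integral_mul_conj_le (hκE y hy').1
    (slice_continuous hg.1 hy').aestronglyMeasurable).trans ?_
  gcongr
  exact eLpNorm_slice_le g hy'

theorem modelKernel_mem_modelSpace {χ : ℍ → ℂ} (hχ : IsInner χ) (w : ℍ) :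
    modelKernel χ w ∈ modelSpace hχ :=
  ⟨modelKernel_mem_hardySpace hχ w, fun _ hg => hasHardyInner_modelKernel hχ w hg⟩

/-! ### Necessary conditions for boundedness -/

/-- The test function is the kernel `k` at `φ(z)`: the point evaluation bound for `k ∘ φ` at `z`
compares `|k(φ(z))|` with `(Im z)^{-1/2} * M * ‖k‖`. -/
theorem bddAbove_of_compBounded {χ : ℍ → ℂ} (hχ : IsInner χ) {φ : ℍ → ℍ}
    (h : CompBounded (modelSpace hχ) φ) :
    BddAbove (Set.range fun z : ℍ => z.im / (φ z).im * (1 - ‖χ (φ z)‖ ^ 2)) := by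
  obtain ⟨M, hM⟩ := h
  refine ⟨96 * Real.pi * M ^ 2, ?_⟩
  rintro _ ⟨z, rfl⟩
  obtain ⟨hmem, hnorm⟩ := hM _ (modelKernel_mem_modelSpace hχ (φ z))
  have hpt := im_mul_norm_sq_le hmem (z := z) z.im_pos
  rw [ofComplex_apply, Function.comp_apply, norm_modelKernel_apply_self] at hpt
  have hv := (φ z).im_pos
  have hz := z.im_pos
  set v := (φ z).im
  set D := 1 - ‖χ (φ z)‖ ^ 2 with hD
  have hD0 : 0 ≤ D := by
    have := pow_le_one₀ (n := 2) (norm_nonneg _) (hχ.norm_le_one (φ z))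
    linarith
  have hreal : (hardyNorm (modelKernel χ (φ z) ∘ φ)).toReal ≤ M * √(8 * Real.pi * D / v) := by
    refine ENNReal.toReal_le_of_le_ofReal (by positivity) (hnorm.trans ?_)
    rw [ENNReal.ofReal_mul M.coe_nonneg, ENNReal.ofReal_coe_nnreal]
    gcongr
    exact hardyNorm_modelKernel_le hχ (φ z)
  have hsq : (hardyNorm (modelKernel χ (φ z) ∘ φ)).toReal ^ 2 ≤ M ^ 2 * (8 * Real.pi * D / v) := by
    refine (pow_le_pow_left₀ ENNReal.toReal_nonneg hreal 2).trans_eq ?_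
    rw [mul_pow, Real.sq_sqrt (by positivity)]
  rw [abs_of_nonneg hD0, coe_im] at hpt
  rcases hD0.eq_or_lt with h0 | hpos
  · change z.im / v * D ≤ _
    rw [← h0, mul_zero]
    positivity
  · have h1 : z.im * (D / (2 * v)) ^ 2 ≤ 3 * (M ^ 2 * (8 * Real.pi * D / v)) :=
      hpt.trans (by gcongr)
    have h2 : D / (4 * v) * (z.im / v * D) ≤ D / (4 * v) * (96 * Real.pi * M ^ 2) := by
      refine le_trans (le_of_eq ?_) (h1.trans (le_of_eq ?_))
      · field_simp
        ring
      · field_simp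
        ring
    exact le_of_mul_le_mul_left h2 (by positivity)

end ModelComp

theorem theorem3p1 (χ : ℍ → ℂ) (hχ : ModelComp.IsInner χ)
    (φ : ℍ → ℍ) (hφ : ModelComp.IsAnalytic (fun z => (φ z : ℂ))) :
    (ModelComp.CompBounded (ModelComp.modelSpace hχ) φ →
      BddAbove (Set.range fun z : ℍ => z.im / (φ z).im * (1 - ‖χ (φ z)‖ ^ 2))) ∧
    (BddAbove (Set.range fun z : ℍ => z.im / (φ z).im) →
      ModelComp.CompBounded (ModelComp.modelSpace hχ) φ) ∧
    (sSup (Set.range fun z : ℍ => ‖χ (φ z)‖) < 1 →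
      ModelComp.CompBounded (ModelComp.modelSpace hχ) φ →
      BddAbove (Set.range fun z : ℍ => z.im / (φ z).im)) := by
  refine ⟨ModelComp.bddAbove_of_compBounded hχ,
    fun h => ModelComp.compBounded_of_bddAbove hφ h fun f hf => hf.1, fun hs hb => ?_⟩
  obtain ⟨K, hK⟩ := ModelComp.bddAbove_of_compBounded hχ hb
  set s := sSup (Set.range fun z : ℍ => ‖χ (φ z)‖) with hsdef
  have hle : ∀ z, ‖χ (φ z)‖ ≤ s := fun z =>
    le_csSup ⟨1, by rintro _ ⟨z, rfl⟩; exact hχ.norm_le_one _⟩ ⟨z, rfl⟩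
  have hs0 : 0 ≤ s := (norm_nonneg _).trans (hle I)
  have hc : 0 < 1 - s ^ 2 := by nlinarith
  refine ⟨K / (1 - s ^ 2), ?_⟩
  rintro _ ⟨z, rfl⟩
  rw [le_div_iff₀ hc]
  refine le_trans ?_ (hK ⟨z, rfl⟩)
  have h0 : 0 ≤ z.im / (φ z).im := div_nonneg z.im_pos.le (φ z).im_pos.le
  dsimp only
  gcongr
  exact hle z
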